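/- Let $K$ be an algebraically closed field of characteristic $0$ and let $E$ be an elliptic curve over $K$, given by a Weierstrass equation. Let $R$ be a commutative ring, contained in a field $F$, acting on $E$ by endomorphisms: we are given an injective ring homomorphism $\omega\mapsto[\omega]$ from $R$ to the ring of endomorphisms of the group $E(K)$ such that every $[\omega]$ is a morphism of varieties (for example, $E$ has complex multiplication by an order $R$ in an imaginary quadratic field $F$). Let $\pi:E\to\mathbb P^1$, $(x,y)\mapsto[x:1]$, $O\mapsto[1:0]$, be the quotient by the hyperelliptic involution $P\mapsto -P$, and for $\omega\in R$ let $\varphi_{[\omega]}:\mathbb P^1\to\mathbb P^1$ be the Lattès map determined by $\varphi_{[\omega]}\circ\pi=\pi\circ[\omega]$. Let $\Delta=\{(P,P):P\in E\}\subset E\times E$ and $\Delta'=\{(P,P):P\in\mathbb P^1\}\subset\mathbb P^1\times\mathbb P^1$ be the diagonals. For a self-map $\varphi:X\to X$ and integers $n\ge 0$, $k>0$, call $Y\subset X$ pre-periodic for $\varphi$ with pair $(n,k)$ if $\varphi^{n+k}(Y)=\varphi^{n}(Y)$ (equality of images). Let $\omega,\omega'\in R$ with $\omega'\neq 0$, and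 let $n\ge 0$ and $k>0$ be integers. 1. If $(\omega/\omega')^k=-1$, then $\Delta'$ is pre-periodic for $\varphi_{[\omega]}\times\varphi_{[\omega']}$ with pair $(n,k)$, but $\Delta$ is not pre-periodic for $[\omega]\times[\omega']$ with pair $(n,k)$. 2. If $(\omega/\omega')^k=1$, then $\Delta$ is pre-periodic for $[\omega]\times[\omega']$ with pair $(n,k)$, and $\Delta'$ is pre-periodic for $\varphi_{[\omega]}\times\varphi_{[\omega']}$ with pair $(n,k)$. -/

import Mathlib

open scoped LinearAlgebra.Projectivization

/-! ### Preperiodic subsets -/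

/-- `Y ⊆ X` is preperiodic for `φ : X → X` with pair `(n, k)`: `k > 0` and the (set-theoretic) images
of `Y` under the iterates `φ^(n+k)` and `φ^n` coincide. -/
def IsPreperiodicWithPair {X : Type*} (φ : X → X) (Y : Set X) (n k : ℕ) : Prop :=
  0 < k ∧ φ^[n + k] '' Y = φ^[n] '' Y

/-! ### Points, regular maps, and rings of endomorphisms of an elliptic curve

For an elliptic curve given by a Weierstrass equation `W` over a field `K`, the set of `K`-points
(including the point at infinity) is `W.toAffine.Point`, with Mathlib's group law. -/

namespace EllipticDiagonal

section Coordinates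

variable {K : Type*} [Field K] {W : WeierstrassCurve K}

/-- Homogeneous coordinates in the plane: `(x, y) ↦ (x, y, 1)`, and `(0, 1, 0)` at infinity. -/
def coords : W.toAffine.Point → Fin 3 → K
  | .zero => ![0, 1, 0]
  | .some x y _ => ![x, y, 1]

theorem coords_ne_zero (P : W.toAffine.Point) : coords P ≠ 0 := by
  cases P with
  | zero => intro h; simpa [coords] using congrFun h 1
  | some x y h => intro h; simpa [coords] using congrFun h 2

/-- The embedding of the curve in the projective plane. -/
def toPlane (P : W.toAffine.Point) : ℙ K (Fin 3 → K) :=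
  Projectivization.mk K (coords P) (coords_ne_zero P)

/-- A self-map `f` of the projective plane curve is regular (a morphism of varieties, for `K`
algebraically closed) if around every point `P` it is given by a triple of homogeneous polynomials
of the same degree: they do not all vanish at `P`, and they give `f` wherever they do not all
vanish. -/
def IsRegular (f : W.toAffine.Point → W.toAffine.Point) : Prop :=
  ∀ P : W.toAffine.Point, ∃ (d : ℕ) (F : Fin 3 → MvPolynomial (Fin 3) K),
    (∀ i, (F i).IsHomogeneous d) ∧
    (fun i => MvPolynomial.eval (coords (W := W) P) (F i)) ≠ 0 ∧
    ∀ (Q : W.toAffine.Point) (hQ : (fun i => MvPolynomial.eval (coords (W := W) Q) (F i)) ≠ 0),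
      toPlane (W := W) (f Q) =
        Projectivization.mk K (fun i => MvPolynomial.eval (coords (W := W) Q) (F i)) hQ

end Coordinates

/-- `R` acts on the elliptic curve by (algebraic) endomorphisms: an injective ring homomorphism
`ω ↦ [ω]` from `R` to the endomorphisms of the group of points, each `[ω]` being a regular map.
An elliptic curve with complex multiplication by `R` is the case where `R` is an order in an
imaginary quadratic field. -/
structure EndomorphismAction {K : Type*} [Field K] [DecidableEq K] (W : WeierstrassCurve K)
    (R : Type*) [CommRing R] where
  /-- The map `ω ↦ [ω]`. -/
  toEnd : R →+* AddMonoid.End W.toAffine.Point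
  injective : Function.Injective toEnd
  regular : ∀ ω : R, IsRegular (toEnd ω)

/-! ### The quotient by the hyperelliptic involution and Lattès maps -/

section Quotient

variable {K : Type*} [Field K] {W : WeierstrassCurve K}

/-- Coordinates of the image in the projective line: `(x, y) ↦ (x, 1)` and `O ↦ (1, 0)`. -/
def xCoords : W.toAffine.Point → Fin 2 → K
  | .zero => ![1, 0]
  | .some x _ _ => ![x, 1]

theorem xCoords_ne_zero (P : W.toAffine.Point) : xCoords P ≠ 0 := by
  cases P with
  | zero => intro h; simpa [xCoords] using congrFun h 0
  | some x y h => intro h; simpa [xCoords] using congrFun h 1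

/-- The map `π : E → ℙ¹`, `(x, y) ↦ [x : 1]`, `O ↦ [1 : 0]`, which is the quotient of `E` by the
hyperelliptic involution `P ↦ -P` (see `hyperelliptic_eq_iff`, `hyperelliptic_surjective`). -/
def hyperelliptic (P : W.toAffine.Point) : ℙ K (Fin 2 → K) :=
  Projectivization.mk K (xCoords P) (xCoords_ne_zero P)

/-- The fibres of `π` are the orbits of the hyperelliptic involution. -/
theorem hyperelliptic_eq_iff (P Q : W.toAffine.Point) :
    hyperelliptic P = hyperelliptic Q ↔ P = Q ∨ P = -Q := by
  unfold hyperelliptic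
  rw [Projectivization.mk_eq_mk_iff']
  rcases P with _ | ⟨x, y, h⟩ <;> rcases Q with _ | ⟨x', y', h'⟩
  · simp [xCoords]
  · constructor
    · rintro ⟨a, ha⟩
      have h0 := congrFun ha 0
      have h1 := congrFun ha 1
      simp only [xCoords, Pi.smul_apply, Matrix.cons_val_zero, Matrix.cons_val_one,
        smul_eq_mul, mul_one] at h0 h1
      simp [h1] at h0
    · rintro (h | h)
      · cases h
      · rw [WeierstrassCurve.Affine.Point.neg_some] at h; cases h
  · constructor
    · rintro ⟨a, ha⟩
      have h1 := congrFun ha 1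
      simp [xCoords] at h1
    · rintro (h | h)
      · cases h
      · change _ = -(0 : W.toAffine.Point) at h
        rw [WeierstrassCurve.Affine.Point.neg_zero] at h; cases h
  · rw [WeierstrassCurve.Affine.Point.neg_some]
    constructor
    · rintro ⟨a, ha⟩
      have h0 := congrFun ha 0
      have h1 := congrFun ha 1
      simp only [xCoords, Pi.smul_apply, Matrix.cons_val_zero, Matrix.cons_val_one,
        smul_eq_mul, mul_one] at h0 h1
      have hx : x = x' := by rw [← h0, h1, one_mul]
      rcases WeierstrassCurve.Affine.Y_eq_of_X_eq h.1 h'.1 hx with hy | hy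
      · left; subst hx; subst hy; rfl
      · right; subst hx; subst hy; rfl
    · rintro (h | h) <;>
      · injection h with hx hy
        exact ⟨1, by simp [xCoords, hx]⟩

/-- `π` is surjective over an algebraically closed field. -/
theorem hyperelliptic_surjective [IsAlgClosed K] [W.IsElliptic] :
    Function.Surjective (hyperelliptic : W.toAffine.Point → ℙ K (Fin 2 → K)) := by
  intro t
  induction t using Projectivization.ind with
  | h v hv =>
    by_cases h1 : v 1 = 0
    · refine ⟨.zero, ?_⟩
      unfold hyperelliptic
      rw [Projectivization.mk_eq_mk_iff']
      have h0 : v 0 ≠ 0 := fun h0 => hv (by ext i; fin_cases i <;> simp [h0, h1])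
      refine ⟨(v 0)⁻¹, ?_⟩
      ext i; fin_cases i <;> simp [xCoords, h0, h1]
    · set x : K := v 0 / v 1 with hx
      let p : Polynomial K := Polynomial.X ^ 2 + Polynomial.C (W.a₁ * x + W.a₃) * Polynomial.X
        - Polynomial.C (x ^ 3 + W.a₂ * x ^ 2 + W.a₄ * x + W.a₆)
      have hp : p.degree ≠ 0 := by
        have : p.degree = 2 := by unfold p; compute_degree!
        rw [this]; decide
      obtain ⟨y, hy⟩ := IsAlgClosed.exists_root p hp
      have hE : W.toAffine.Equation x y := by
        rw [WeierstrassCurve.Affine.equation_iff]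
        simp only [p, Polynomial.IsRoot, Polynomial.eval_sub, Polynomial.eval_add,
          Polynomial.eval_mul, Polynomial.eval_pow, Polynomial.eval_X, Polynomial.eval_C] at hy
        linear_combination hy
      refine ⟨.some x y (WeierstrassCurve.Affine.equation_iff_nonsingular.mp hE), ?_⟩
      unfold hyperelliptic
      rw [Projectivization.mk_eq_mk_iff']
      refine ⟨(v 1)⁻¹, ?_⟩
      ext i; fin_cases i
      · simp [xCoords, hx, div_eq_inv_mul]
      · simp [xCoords, h1]

variable [IsAlgClosed K] [DecidableEq K] [W.IsElliptic]

/-- The Lattès map `φ_f : ℙ¹ → ℙ¹` induced by an endomorphism `f` of `E`: it sends `π P` to `π (f P)`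
(see `lattes_hyperelliptic`). -/
noncomputable def lattes (f : AddMonoid.End W.toAffine.Point) (t : ℙ K (Fin 2 → K)) :
    ℙ K (Fin 2 → K) :=
  hyperelliptic (f (Function.surjInv (hyperelliptic_surjective (W := W)) t))

/-- `φ_f ∘ π = π ∘ f`. As `π` is surjective, this determines `φ_f`. -/
theorem lattes_hyperelliptic (f : AddMonoid.End W.toAffine.Point) (P : W.toAffine.Point) :
    lattes f (hyperelliptic P) = hyperelliptic (f P) := by
  unfold lattes
  rw [hyperelliptic_eq_iff]
  rcases (hyperelliptic_eq_iff _ _).mp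
    (Function.surjInv_eq (hyperelliptic_surjective (W := W)) (hyperelliptic P)) with h | h
  · left; rw [h]
  · right; rw [h]; exact map_neg f P

end Quotient

end EllipticDiagonal

open EllipticDiagonal

/-!
The heart of the matter is that a nonzero regular endomorphism `f` of `E` is surjective on points
(`EllipticDiagonal.surjective_of_isRegular`). A nonzero function `p(x) + q(x) y` on the curve has
finitely many zeros, because its norm to `K[x]` is a nonzero polynomial. Hence the triple of
polynomials that gives `f` near a single point gives it at all but finitely many points, and, as `f`
commutes with negation, the abscissa of `f(P)` is there a quotient of polynomials in the abscissa of
`P` (`EllipticDiagonal.exists_rational_x`). If this quotient is not constant, it takes almost all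
values in `K`, so the range of `f` is a subgroup with finite complement in an infinite group, hence
everything. If it is constant, then `f` has finite range and finite kernel, which is absurd.

Now let `ω ^ k = ε ω' ^ k` with `ε = ±1`. The image of `Δ` under the `(n + k)`-th iterate consists of
the pairs `(ε [ω ^ n] Q, [ω' ^ n] Q)` with `Q = [ω' ^ k] P`, and `Q` runs over all of `E` by
surjectivity. If `ε = 1`, this is the image under the `n`-th iterate; on `ℙ¹` the sign disappears. If
`ε = -1` and the two images in `E × E` were equal, `2 ω ^ n ω' ^ (n + k)` would kill `E`, hence be
zero; but `R` is a domain, and `2 ≠ 0` in `R` as `E` is not killed by `2`.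
-/

open Filter Polynomial

/-! ### Additive groups and their endomorphisms -/

/-- In an infinite group, a subgroup `H` with finite complement is everything: `H` meets each of its
own translates. -/
theorem AddSubgroup.eq_top_of_eventually_mem {G : Type*} [AddGroup G] [Infinite G]
    (H : AddSubgroup G) (h : ∀ᶠ g in cofinite, g ∈ H) : H = ⊤ := by
  refine (AddSubgroup.eq_top_iff' H).mpr fun g => ?_
  have h' : ∀ᶠ x in cofinite, g + x ∈ H := (add_right_injective g).tendsto_cofinite.eventually h
  obtain ⟨x, hx, hgx⟩ := (h.and h').exists
  simpa using H.sub_mem hgx hx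

/-- The nonempty fibres of `f` are translates of the kernel. -/
theorem AddMonoidHom.finite_of_finite_range_of_finite_ker {G H : Type*} [AddGroup G] [AddGroup H]
    (f : G →+ H) (hr : (Set.range f).Finite) (hk : {x | f x = 0}.Finite) : Finite G := by
  rw [← Set.finite_univ_iff, ← Set.preimage_range f]
  refine hr.preimage' ?_
  rintro _ ⟨a, rfl⟩
  refine (hk.image (· + a)).subset fun x hx => ⟨x - a, ?_, sub_add_cancel x a⟩
  have hx : f x = f a := hx
  simp [hx]

theorem AddMonoid.End.image_diagonal_iterate_prodMap {A : Type*} [AddMonoid A]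
    (f g : AddMonoid.End A) (m : ℕ) :
    (Prod.map f g)^[m] '' Set.diagonal A = Set.range fun P => ((f ^ m) P, (g ^ m) P) := by
  rw [Prod.map_iterate, ← AddMonoid.End.coe_pow, ← AddMonoid.End.coe_pow,
    ← Set.range_diag, ← Set.range_comp]
  rfl

theorem RingHom.toEnd_pow_add_apply {R A : Type*} [Semiring R] [AddCommMonoid A]
    (φ : R →+* AddMonoid.End A) (a : R) (n k : ℕ) (P : A) :
    (φ a ^ (n + k)) P = (φ a ^ n) (φ (a ^ k) P) := by
  rw [pow_add, map_pow]
  rfl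

namespace EllipticDiagonal

section Generic

variable {K : Type*} [Field K] {W : WeierstrassCurve K}

/-! ### Functions on the curve and their zeros -/

theorem finite_setOf_x_mem {S : Set K} (hS : S.Finite) :
    {P : W.toAffine.Point | ∃ x y h, P = .some x y h ∧ x ∈ S}.Finite := by
  have : {P : W.toAffine.Point | ∃ x y h, P = .some x y h ∧ x ∈ S} =
      ⋃ x ∈ S, {P : W.toAffine.Point | ∃ y h, P = .some x y h} := by
    ext P
    simp only [Set.mem_ofPred_eq, Set.mem_iUnion, exists_prop]
    constructor
    · rintro ⟨x, y, h, rfl, hx⟩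
      exact ⟨x, hx, y, h, rfl⟩
    · rintro ⟨x, hx, y, h, rfl⟩
      exact ⟨x, y, h, rfl, hx⟩
  rw [this]
  refine hS.biUnion fun x _ => ?_
  rcases Set.eq_empty_or_nonempty {P : W.toAffine.Point | ∃ y h, P = .some x y h} with h0 | ⟨P, hP⟩
  · rw [h0]
    exact Set.finite_empty
  · refine (Set.toFinite {P, -P}).subset ?_
    obtain ⟨y, h, rfl⟩ := hP
    rintro _ ⟨y', h', rfl⟩
    refine (hyperelliptic_eq_iff _ _).mp ?_
    unfold hyperelliptic
    rfl

theorem eventually_x_notMem {S : Set K} (hS : S.Finite) :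
    ∀ᶠ P : W.toAffine.Point in cofinite, ∀ x y h, P = .some x y h → x ∉ S := by
  rw [eventually_cofinite]
  refine (finite_setOf_x_mem (W := W) hS).subset fun P hP => ?_
  simp only [Set.mem_ofPred_eq, not_forall, not_not] at hP ⊢
  obtain ⟨x, y, h, hP, hx⟩ := hP
  exact ⟨x, y, h, hP, hx⟩

theorem eventually_eval_x_ne_zero {p : K[X]} (hp : p ≠ 0) :
    ∀ᶠ P : W.toAffine.Point in cofinite, ∀ x y h, P = .some x y h → p.eval x ≠ 0 := by
  filter_upwards [eventually_x_notMem (W := W) (p.finite_setOfPred_isRoot hp)] with P hP x y h hPx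
  exact hP x y h hPx

/-- The norm of the function `p(x) + q(x) y` on the curve to the polynomials in `x`. -/
noncomputable def normPoly (W : WeierstrassCurve K) (p q : K[X]) : K[X] :=
  p ^ 2 - p * q * (C W.a₁ * X + C W.a₃) - q ^ 2 * (X ^ 3 + C W.a₂ * X ^ 2 + C W.a₄ * X + C W.a₆)

theorem normPoly_ne_zero {p q : K[X]} (h : p ≠ 0 ∨ q ≠ 0) : normPoly W p q ≠ 0 := by
  intro h0
  have hd := WeierstrassCurve.Affine.CoordinateRing.degree_norm_smul_basis (W' := W.toAffine) p q
  rw [WeierstrassCurve.Affine.CoordinateRing.norm_smul_basis] at hd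
  change (normPoly W p q).degree = _ at hd
  rw [h0, degree_zero, eq_comm, max_eq_bot] at hd
  rcases h with h | h
  · rw [degree_eq_natDegree h] at hd
    exact absurd hd.1 (by rw [← WithBot.coe_natCast, ← WithBot.coe_nsmul]; exact WithBot.coe_ne_bot)
  · rw [degree_eq_natDegree h] at hd
    refine absurd hd.2 ?_
    rw [← WithBot.coe_natCast, ← WithBot.coe_nsmul]
    exact WithBot.coe_ne_bot (a := 2 • q.natDegree + 3)

theorem eval_normPoly {x y : K} (h : W.toAffine.Equation x y) (p q : K[X]) :
    (normPoly W p q).eval x =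
      (p.eval x + q.eval x * y) * (p.eval x + q.eval x * W.toAffine.negY x y) := by
  rw [WeierstrassCurve.Affine.equation_iff] at h
  simp only [normPoly, WeierstrassCurve.Affine.negY, eval_sub, eval_add, eval_mul, eval_pow, eval_X,
    eval_C]
  linear_combination (q.eval x) ^ 2 * h

theorem eventually_eval_add_mul_ne_zero {p q : K[X]} (hpq : p ≠ 0 ∨ q ≠ 0) :
    ∀ᶠ P : W.toAffine.Point in cofinite, ∀ x y h, P = .some x y h →
      p.eval x + q.eval x * y ≠ 0 := by
  filter_upwards [eventually_eval_x_ne_zero (W := W) (normPoly_ne_zero hpq)] with P hP x y h hPx h0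
  refine hP x y h hPx ?_
  rw [eval_normPoly h.1, h0, zero_mul]

/-- Modulo the Weierstrass equation, every polynomial in `x` and `y` is linear in `y`. -/
theorem exists_eval_coords (W : WeierstrassCurve K) (G : MvPolynomial (Fin 3) K) :
    ∃ p q : K[X], ∀ x y h, MvPolynomial.eval (coords (W := W) (.some x y h)) G =
      p.eval x + q.eval x * y := by
  induction G using MvPolynomial.induction_on with
  | C a => exact ⟨C a, 0, fun x y h => by simp⟩
  | add G H hG hH =>
    obtain ⟨p, q, hG⟩ := hG
    obtain ⟨p', q', hH⟩ := hH
    exact ⟨p + p', q + q', fun x y h => by rw [map_add, hG, hH, eval_add, eval_add]; ring⟩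
  | mul_X G i hG =>
    obtain ⟨p, q, hG⟩ := hG
    fin_cases i
    · refine ⟨p * X, q * X, fun x y h => ?_⟩
      simp only [map_mul, hG, MvPolynomial.eval_X]
      simp only [coords, eval_mul, eval_X, Fin.zero_eta, Matrix.cons_val_zero]
      ring
    · refine ⟨q * (X ^ 3 + C W.a₂ * X ^ 2 + C W.a₄ * X + C W.a₆), p - q * (C W.a₁ * X + C W.a₃),
        fun x y h => ?_⟩
      have hE := (WeierstrassCurve.Affine.equation_iff ..).mp h.1
      simp only [map_mul, hG, MvPolynomial.eval_X]
      simp only [coords, eval_mul, eval_X, eval_add, eval_sub, eval_pow, eval_C, Fin.mk_one,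
        Matrix.cons_val_one, Matrix.cons_val_zero]
      linear_combination (q.eval x) * hE
    · refine ⟨p, q, fun x y h => ?_⟩
      simp only [map_mul, hG, MvPolynomial.eval_X]
      simp [coords]

end Generic

/-! ### Points over an algebraically closed field -/

section AlgClosed

variable {K : Type*} [Field K] [IsAlgClosed K] {W : WeierstrassCurve K} [W.IsElliptic]

theorem exists_nonsingular (W : WeierstrassCurve K) [W.IsElliptic] (x : K) :
    ∃ y, W.toAffine.Nonsingular x y := by
  obtain ⟨P, hP⟩ := hyperelliptic_surjective (W := W)
    (Projectivization.mk K ![x, 1] (fun h => by simpa using congrFun h 1))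
  unfold hyperelliptic at hP
  rw [Projectivization.mk_eq_mk_iff'] at hP
  obtain ⟨a, ha⟩ := hP
  have h0 := congrFun ha 0
  have h1 := congrFun ha 1
  rcases P with _ | ⟨x', y, h⟩ <;>
    simp only [xCoords, Pi.smul_apply, Matrix.cons_val_zero, Matrix.cons_val_one,
      smul_eq_mul, mul_one] at h0 h1
  · simp [h1] at h0
  · refine ⟨y, ?_⟩
    rwa [← h0, h1, one_mul] at h

instance infinite_point : Infinite W.toAffine.Point := by
  have : Infinite K := IsAlgClosed.instInfinite
  choose y h using exists_nonsingular W
  refine Infinite.of_injective (fun x => (.some x (y x) (h x) : W.toAffine.Point)) fun x x' hx => ?_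
  injection hx

variable [DecidableEq K]

/-! ### The abscissa of the image is a rational function of the abscissa -/

/-- If `f` is a nonzero regular endomorphism, then `x ∘ f` is generically a quotient of functions
`p(x) + q(x) y`. The denominator is not zero, since otherwise `f` would be generically zero, so that
its kernel would have finite complement. -/
theorem exists_linear_quotient {f : W.toAffine.Point →+ W.toAffine.Point} (hf : IsRegular f)
    (hf0 : f ≠ 0) :
    ∃ p q r s : K[X], (r ≠ 0 ∨ s ≠ 0) ∧
      ∀ᶠ P : W.toAffine.Point in cofinite, ∀ x y h, P = .some x y h →
        ∃ x' y' h', f P = .some x' y' h' ∧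
          x' * (r.eval x + s.eval x * y) = p.eval x + q.eval x * y := by
  obtain ⟨y₀, h₀⟩ := exists_nonsingular W 0
  obtain ⟨d, G, -, hG₀, hG⟩ := hf (.some 0 y₀ h₀)
  choose p q hpq using fun i => exists_eval_coords W (G i)
  obtain ⟨i, hi⟩ := Function.ne_iff.mp hG₀
  have hpqi : p i ≠ 0 ∨ q i ≠ 0 := by
    by_contra! h
    apply hi
    simp [hpq, h.1, h.2]
  have hne : ∀ᶠ P : W.toAffine.Point in cofinite,
      (fun i => MvPolynomial.eval (coords (W := W) P) (G i)) ≠ 0 := by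
    filter_upwards [eventually_eval_add_mul_ne_zero (W := W) hpqi, eventually_cofinite_ne 0]
      with P hP hP0 h
    rcases P with _ | ⟨x, y, hxy⟩
    · exact hP0 rfl
    · exact hP x y hxy rfl (by rw [← hpq i x y hxy]; exact congrFun h i)
  -- If the last coordinate vanished on the curve, `f` would be generically zero.
  have hpq2 : p 2 ≠ 0 ∨ q 2 ≠ 0 := by
    by_contra! h
    apply hf0
    have hker : f.ker = ⊤ := by
      refine AddSubgroup.eq_top_of_eventually_mem _ ?_
      filter_upwards [hne, eventually_cofinite_ne 0] with P hP hP0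
      have hfP := hG P hP
      rcases P with _ | ⟨x, y, hxy⟩
      · exact absurd rfl hP0
      · rw [AddMonoidHom.mem_ker]
        unfold toPlane at hfP
        rw [Projectivization.mk_eq_mk_iff'] at hfP
        obtain ⟨a, ha⟩ := hfP
        have ha2 := congrFun ha 2
        simp only [Pi.smul_apply, hpq, h.1, h.2, smul_eq_mul, eval_zero, zero_mul, add_zero,
          mul_zero] at ha2
        generalize f (.some x y hxy) = Q at ha2 ⊢
        rcases Q with _ | ⟨x', y', h'⟩
        · rfl
        · simp [coords] at ha2
    ext P
    have : P ∈ f.ker := by rw [hker]; trivial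
    exact this
  refine ⟨p 0, q 0, p 2, q 2, hpq2, ?_⟩
  filter_upwards [hne, eventually_eval_add_mul_ne_zero (W := W) hpq2] with P hP hP2 x y hxy hPx
  subst hPx
  have hfP := hG _ hP
  have hz := hP2 x y hxy rfl
  unfold toPlane at hfP
  rw [Projectivization.mk_eq_mk_iff'] at hfP
  obtain ⟨a, ha⟩ := hfP
  have ha2 := congrFun ha 2
  have ha0 := congrFun ha 0
  simp only [Pi.smul_apply, hpq, smul_eq_mul] at ha2 ha0
  generalize hfQ : f (.some x y hxy) = Q at ha2 ha0 ⊢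
  rcases Q with _ | ⟨x', y', h'⟩
  · -- The last coordinate is nonzero, so `f` does not take the value `O` here.
    have ha20 : a = 0 := by simpa [coords, hz] using ha2
    have ha1 := congrFun ha 1
    rw [hfQ, ha20] at ha1
    simp [coords] at ha1
  · refine ⟨x', y', h', rfl, ?_⟩
    simp only [coords, Matrix.cons_val] at ha0 ha2
    rw [← ha0]
    linear_combination ((p 0).eval x + (q 0).eval x * y) * ha2

/-- If `f` is a nonzero regular endomorphism, then, for all but finitely many `P`, `x(f(P))` is
`u(x(P)) / N(x(P))`. Writing `x ∘ f` as a quotient of polynomials in `x` and `y`, one averages over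
`P` and `-P`, whose images under `f` have the same abscissa: this removes `y`. -/
theorem exists_rational_x {f : W.toAffine.Point →+ W.toAffine.Point} (hf : IsRegular f)
    (hf0 : f ≠ 0) (h2 : (2 : K) ≠ 0) :
    ∃ u N : K[X], IsCoprime u N ∧ ∀ᶠ P : W.toAffine.Point in cofinite, ∀ x y h, P = .some x y h →
      ∃ x' y' h', f P = .some x' y' h' ∧ x' * N.eval x = u.eval x := by
  obtain ⟨p, q, r, s, hrs, hN⟩ := exists_linear_quotient hf hf0
  set u : K[X] := 2 * (p * r) - (p * s + q * r) * (C W.a₁ * X + C W.a₃) -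
    2 * (q * s) * (X ^ 3 + C W.a₂ * X ^ 2 + C W.a₄ * X + C W.a₆) with hu
  set N : K[X] := C 2 * normPoly W r s with hN'
  have hN0 : N ≠ 0 := mul_ne_zero (C_ne_zero.mpr h2) (normPoly_ne_zero hrs)
  have huN : ∀ᶠ P : W.toAffine.Point in cofinite, ∀ x y h, P = .some x y h →
      ∃ x' y' h', f P = .some x' y' h' ∧ x' * N.eval x = u.eval x := by
    filter_upwards [hN, neg_injective.tendsto_cofinite.eventually hN] with P hP hP' x y hxy hPx
    obtain ⟨x', y', h', hfP, he⟩ := hP x y hxy hPx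
    obtain ⟨x'', y'', h'', hfP', he'⟩ := hP' x _ _
      (by rw [hPx, WeierstrassCurve.Affine.Point.neg_some])
    rw [map_neg, hfP, WeierstrassCurve.Affine.Point.neg_some] at hfP'
    injection hfP' with hx
    subst hx
    refine ⟨x', y', h', hfP, ?_⟩
    have hE := (WeierstrassCurve.Affine.equation_iff ..).mp hxy.1
    rw [hN', eval_mul, eval_normPoly hxy.1, eval_C]
    rw [WeierstrassCurve.Affine.negY] at he' ⊢
    simp only [hu, eval_sub, eval_add, eval_mul, eval_pow, eval_X, eval_C, eval_ofNat]
    linear_combination (r.eval x + s.eval x * (-y - W.a₁ * x - W.a₃)) * he +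
      (r.eval x + s.eval x * y) * he' - 2 * q.eval x * s.eval x * hE
  clear_value u N
  let _ := EuclideanDomain.gcdMonoid K[X]
  have hg0 : GCDMonoid.gcd u N ≠ 0 := gcd_ne_zero_of_right hN0
  refine ⟨u / GCDMonoid.gcd u N, N / GCDMonoid.gcd u N, isCoprime_div_gcd_div_gcd hN0, ?_⟩
  filter_upwards [huN, eventually_eval_x_ne_zero (W := W) hg0] with P hP hgP x y hxy hPx
  obtain ⟨x', y', h', hfP, he⟩ := hP x y hxy hPx
  refine ⟨x', y', h', hfP, mul_left_cancel₀ (hgP x y hxy hPx) ?_⟩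
  rw [mul_left_comm, ← eval_mul, ← eval_mul,
    EuclideanDomain.mul_div_cancel' hg0 (gcd_dvd_left u N),
    EuclideanDomain.mul_div_cancel' hg0 (gcd_dvd_right u N), he]

/-! ### Nonzero regular endomorphisms are surjective -/

/-- The value `c` of a quotient `u / N` in lowest terms is attained outside a given finite set, except
for finitely many `c`, unless `u` and `N` are constant. -/
theorem finite_setOf_not_exists_eval_eq {u N : K[X]} (huN : IsCoprime u N)
    (hc : ¬ (u.natDegree = 0 ∧ N.natDegree = 0)) {B : Set K} (hB : B.Finite) :
    {c : K | ¬ ∃ r, r ∉ B ∧ N.eval r ≠ 0 ∧ c * N.eval r = u.eval r}.Finite := by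
  have hsub : {c : K | (u - C c * N).natDegree = 0}.Subsingleton := by
    intro c (h : (u - C c * N).natDegree = 0) c' (h' : (u - C c' * N).natDegree = 0)
    by_contra hcc
    obtain ⟨a, ha⟩ := natDegree_eq_zero.mp h
    obtain ⟨a', ha'⟩ := natDegree_eq_zero.mp h'
    have hd : c' - c ≠ 0 := sub_ne_zero.mpr (Ne.symm hcc)
    have hN : N = C ((a - a') / (c' - c)) := by
      refine mul_left_cancel₀ (C_ne_zero.mpr hd) ?_
      rw [← C_mul, mul_div_cancel₀ _ hd, C_sub, C_sub, ha, ha']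
      ring
    have hu : u = C (a + c * ((a - a') / (c' - c))) := by
      rw [C_add, C_mul, ha, ← hN]
      ring
    exact hc ⟨by rw [hu, natDegree_C], by rw [hN, natDegree_C]⟩
  refine (hsub.finite.union (hB.image fun r => u.eval r / N.eval r)).subset fun c hc' => ?_
  by_cases hdeg : (u - C c * N).natDegree = 0
  · exact Or.inl hdeg
  · obtain ⟨r, hr⟩ := IsAlgClosed.exists_root (u - C c * N)
      (fun h => hdeg (natDegree_eq_of_degree_eq_some h))
    have hr : c * N.eval r = u.eval r := by
      have hr := IsRoot.def.mp hr
      rw [eval_sub, eval_mul, eval_C] at hr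
      linear_combination -hr
    have hNr : N.eval r ≠ 0 := by
      intro h0
      obtain ⟨a, b, hab⟩ := huN
      have := congrArg (eval r) hab
      rw [eval_add, eval_mul, eval_mul, ← hr, h0, eval_one] at this
      simp at this
    refine Or.inr ⟨r, ?_, (div_eq_iff hNr).mpr hr.symm⟩
    by_contra hrB
    exact hc' ⟨r, hrB, hNr, hr⟩

theorem surjective_of_isRegular {f : W.toAffine.Point →+ W.toAffine.Point} (hf : IsRegular f)
    (hf0 : f ≠ 0) (h2 : (2 : K) ≠ 0) : Function.Surjective f := by
  obtain ⟨u, N, huN, hx⟩ := exists_rational_x hf hf0 h2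
  by_cases hc : u.natDegree = 0 ∧ N.natDegree = 0
  · -- If `x ∘ f` were generically constant, `f` would have finite range and finite kernel.
    exfalso
    obtain ⟨a, rfl⟩ := natDegree_eq_zero.mp hc.1
    obtain ⟨b, rfl⟩ := natDegree_eq_zero.mp hc.2
    simp only [eval_C] at hx
    have hb : b ≠ 0 := by
      rintro rfl
      obtain ⟨P, hP, hP0⟩ := (hx.and (eventually_cofinite_ne 0)).exists
      rcases P with _ | ⟨x, y, h⟩
      · exact hP0 rfl
      · obtain ⟨x', y', h', -, he⟩ := hP x y h rfl
        rw [mul_zero] at he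
        subst he
        exact not_isCoprime_zero_zero (by simpa using huN)
    have hgen : ∀ᶠ P : W.toAffine.Point in cofinite,
        f P ≠ 0 ∧ f P ∈ {Q : W.toAffine.Point | ∃ x y h, Q = .some x y h ∧ x ∈ ({a / b} : Set K)} := by
      filter_upwards [hx, eventually_cofinite_ne 0] with P hP hP0
      rcases P with _ | ⟨x, y, h⟩
      · exact absurd rfl hP0
      · obtain ⟨x', y', h', hfP, he⟩ := hP x y h rfl
        rw [hfP]
        exact ⟨nofun, x', y', h', rfl, (eq_div_iff hb).mpr he⟩
    rw [eventually_cofinite] at hgen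
    refine (infinite_point (W := W)).not_finite (f.finite_of_finite_range_of_finite_ker ?_ ?_)
    · refine ((finite_setOf_x_mem (W := W) (Set.finite_singleton (a / b))).union
        (hgen.image f)).subset ?_
      rintro _ ⟨P, rfl⟩
      by_cases hP : f P ≠ 0 ∧
          f P ∈ {Q : W.toAffine.Point | ∃ x y h, Q = .some x y h ∧ x ∈ ({a / b} : Set K)}
      · exact Or.inl hP.2
      · exact Or.inr ⟨P, hP, rfl⟩
    · exact hgen.subset fun P hP hP' => hP'.1 hP
  · -- Avoid the abscissas of the finitely many points where `x ∘ f = u / N` may fail.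
    rw [eventually_cofinite] at hx
    have hfin := finite_setOf_not_exists_eval_eq huN hc (hx.image fun P => coords P 0)
    refine AddMonoidHom.range_eq_top.mp (AddSubgroup.eq_top_of_eventually_mem _ ?_)
    filter_upwards [eventually_x_notMem (W := W) hfin, eventually_cofinite_ne 0] with T hT hT0
    rcases T with _ | ⟨c, d, h⟩
    · exact absurd rfl hT0
    have := hT c d h rfl
    simp only [not_not] at this
    obtain ⟨r, hrB, hNr, hr⟩ := this
    obtain ⟨y, hy⟩ := exists_nonsingular W r
    have hgood : ∃ x' y' h', f (.some r y hy) = .some x' y' h' ∧ x' * N.eval r = u.eval r := by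
      by_contra hbad
      refine hrB ⟨.some r y hy, fun hP => hbad (hP r y hy rfl), ?_⟩
      simp [coords]
    obtain ⟨x', y', h', hfP, he⟩ := hgood
    have hx' : c = x' := mul_right_cancel₀ hNr (hr.trans he.symm)
    subst hx'
    have heq : hyperelliptic (W := W) (.some c d h) = hyperelliptic (.some c y' h') := by
      unfold hyperelliptic
      rfl
    rcases (hyperelliptic_eq_iff _ _).mp heq with h1 | h1
    · exact ⟨_, hfP.trans h1.symm⟩
    · exact ⟨-.some r y hy, by rw [map_neg, hfP, h1]⟩

/-- Not every point is `2`-torsion: `2 y + a₁ x + a₃` has finitely many zeros on the curve. -/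
theorem exists_add_self_ne_zero (W : WeierstrassCurve K) [W.IsElliptic] (h2 : (2 : K) ≠ 0) :
    ∃ P : W.toAffine.Point, P + P ≠ 0 := by
  have hq : (C W.a₁ * X + C W.a₃ : K[X]) ≠ 0 ∨ (C 2 : K[X]) ≠ 0 := Or.inr (C_ne_zero.mpr h2)
  obtain ⟨P, hP, hP0⟩ := ((eventually_eval_add_mul_ne_zero (W := W) hq).and
    (eventually_cofinite_ne 0)).exists
  rcases P with _ | ⟨x, y, h⟩
  · exact absurd rfl hP0
  refine ⟨.some x y h, fun h0 => hP x y h rfl ?_⟩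
  rw [add_eq_zero_iff_eq_neg, WeierstrassCurve.Affine.Point.neg_some] at h0
  injection h0 with _ hy
  rw [WeierstrassCurve.Affine.negY] at hy
  simp only [eval_add, eval_mul, eval_X, eval_C]
  linear_combination hy

/-! ### Images of the diagonals -/

theorem lattes_iterate_hyperelliptic (f : AddMonoid.End W.toAffine.Point) (m : ℕ)
    (P : W.toAffine.Point) :
    (lattes f)^[m] (hyperelliptic P) = hyperelliptic ((f ^ m) P) := by
  rw [AddMonoid.End.coe_pow]
  exact (Function.Semiconj.iterate_right (f := hyperelliptic) (lattes_hyperelliptic f · |>.symm)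
    m P).symm

theorem image_diagonal_iterate_lattes (f g : AddMonoid.End W.toAffine.Point) (m : ℕ) :
    (Prod.map (lattes f) (lattes g))^[m] '' Set.diagonal (ℙ K (Fin 2 → K)) =
      Set.range fun P => (hyperelliptic ((f ^ m) P), hyperelliptic ((g ^ m) P)) := by
  rw [Prod.map_iterate, ← Set.range_diag, ← Set.range_comp,
    ← (hyperelliptic_surjective (W := W)).range_comp]
  congr 1
  ext1 P
  simp [lattes_iterate_hyperelliptic]

section Action

variable {R : Type*} [CommRing R] (E : EndomorphismAction W R) {k : ℕ}

theorem toEnd_surjective {ω : R} (hω : ω ≠ 0) (h2 : (2 : K) ≠ 0) :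
    Function.Surjective (E.toEnd ω) :=
  surjective_of_isRegular (E.regular ω)
    (fun h => hω (E.injective (h.trans (map_zero E.toEnd).symm))) h2

theorem two_ne_zero_of_endomorphismAction (E : EndomorphismAction W R) (h2 : (2 : K) ≠ 0) :
    (2 : R) ≠ 0 := by
  intro h
  obtain ⟨P, hP⟩ := exists_add_self_ne_zero W h2
  apply hP
  have := congrArg (fun g : AddMonoid.End W.toAffine.Point => g P)
    ((map_ofNat E.toEnd 2).symm.trans (congrArg E.toEnd h))
  rw [map_zero] at this
  rw [← two_nsmul]
  simpa using this

theorem isPreperiodicWithPair_diagonal_lattes {ω ω' : R}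
    (hω' : Function.Surjective (E.toEnd (ω' ^ k))) (hk : 0 < k)
    (h : ω ^ k = ω' ^ k ∨ ω ^ k = -ω' ^ k) (n : ℕ) :
    IsPreperiodicWithPair (Prod.map (lattes (E.toEnd ω)) (lattes (E.toEnd ω')))
      (Set.diagonal (ℙ K (Fin 2 → K))) n k := by
  refine ⟨hk, ?_⟩
  rw [image_diagonal_iterate_lattes, image_diagonal_iterate_lattes]
  refine Eq.trans ?_ (hω'.range_comp _)
  congr 1
  ext1 P
  simp only [Function.comp_apply, RingHom.toEnd_pow_add_apply]
  congr 1
  rw [hyperelliptic_eq_iff]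
  rcases h with h | h
  · left; rw [h]
  · right
    rw [h, map_neg E.toEnd, ← map_neg (E.toEnd ω ^ n)]
    rfl

/-- Equality of the two images would give, for every `P`, a point `Q` such that `Q + [ω' ^ k] P` is
killed by `[ω ^ n]` and `Q - [ω' ^ k] P` by `[ω' ^ n]`; then `2 ω ^ n ω' ^ (n + k)` would kill every
point, and so be zero in the domain `R`. -/
theorem not_isPreperiodicWithPair_diagonal [IsDomain R] {ω ω' : R} (hω : ω ≠ 0) (hω' : ω' ≠ 0)
    (h2 : (2 : K) ≠ 0) (h : ω ^ k = -ω' ^ k) (n : ℕ) :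
    ¬ IsPreperiodicWithPair (Prod.map (E.toEnd ω) (E.toEnd ω'))
      (Set.diagonal W.toAffine.Point) n k := by
  rintro ⟨-, hpre⟩
  rw [AddMonoid.End.image_diagonal_iterate_prodMap,
    AddMonoid.End.image_diagonal_iterate_prodMap] at hpre
  have hne : 2 * ω ^ n * ω' ^ n * ω' ^ k ≠ 0 :=
    mul_ne_zero (mul_ne_zero (mul_ne_zero (two_ne_zero_of_endomorphismAction E h2)
      (pow_ne_zero n hω)) (pow_ne_zero n hω')) (pow_ne_zero k hω')
  refine hne (E.injective ?_)
  ext P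
  obtain ⟨Q, hQ⟩ := hpre.subset ⟨P, rfl⟩
  rw [Prod.mk.injEq, RingHom.toEnd_pow_add_apply, RingHom.toEnd_pow_add_apply, h,
    ← map_pow, ← map_pow] at hQ
  obtain ⟨h1, h2⟩ := hQ
  have e1 := congrArg (E.toEnd (ω' ^ n)) h1
  have e2 := congrArg (E.toEnd (ω ^ n)) h2
  have hmul (a b : R) (S : W.toAffine.Point) : E.toEnd a (E.toEnd b S) = E.toEnd (a * b) S := by
    rw [map_mul]
    rfl
  simp only [hmul] at e1 e2
  rw [mul_comm (ω' ^ n) (ω ^ n), e2] at e1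
  have e3 : E.toEnd (2 * ω ^ n * ω' ^ n * ω' ^ k) =
      E.toEnd (ω ^ n * (ω' ^ n * ω' ^ k)) - E.toEnd (ω' ^ n * (ω ^ n * -ω' ^ k)) := by
    rw [← map_sub]
    congr 1
    ring
  rw [e3, map_zero]
  exact sub_eq_zero.mpr e1

end Action

end AlgClosed

theorem isPreperiodicWithPair_diagonal {K : Type*} [Field K] [DecidableEq K]
    {W : WeierstrassCurve K} {R : Type*} [CommRing R] (E : EndomorphismAction W R) {k : ℕ}
    {ω ω' : R} (hω' : Function.Surjective (E.toEnd (ω' ^ k)))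
    (hk : 0 < k) (h : ω ^ k = ω' ^ k) (n : ℕ) :
    IsPreperiodicWithPair (Prod.map (E.toEnd ω) (E.toEnd ω'))
      (Set.diagonal W.toAffine.Point) n k := by
  refine ⟨hk, ?_⟩
  rw [AddMonoid.End.image_diagonal_iterate_prodMap, AddMonoid.End.image_diagonal_iterate_prodMap]
  refine Eq.trans ?_ (hω'.range_comp _)
  congr 1
  ext1 P
  simp only [Function.comp_apply, RingHom.toEnd_pow_add_apply, h]

end EllipticDiagonal

theorem corollary2p4 {K : Type*} [Field K] [IsAlgClosed K] [CharZero K] [DecidableEq K]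
    (W : WeierstrassCurve K) [W.IsElliptic]
    {F : Type*} [Field F] (R : Subring F) (E : EndomorphismAction W R)
    (ω ω' : R) (hω' : ω' ≠ 0) (n k : ℕ) (hk : 0 < k) :
    (((ω : F) / (ω' : F)) ^ k = -1 →
      IsPreperiodicWithPair (Prod.map (lattes (E.toEnd ω)) (lattes (E.toEnd ω')))
        (Set.diagonal (ℙ K (Fin 2 → K))) n k ∧
      ¬ IsPreperiodicWithPair (Prod.map (E.toEnd ω) (E.toEnd ω'))
        (Set.diagonal W.toAffine.Point) n k) ∧
    (((ω : F) / (ω' : F)) ^ k = 1 →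
      IsPreperiodicWithPair (Prod.map (E.toEnd ω) (E.toEnd ω'))
        (Set.diagonal W.toAffine.Point) n k ∧
      IsPreperiodicWithPair (Prod.map (lattes (E.toEnd ω)) (lattes (E.toEnd ω')))
        (Set.diagonal (ℙ K (Fin 2 → K))) n k) := by
  have h2 : (2 : K) ≠ 0 := two_ne_zero
  have hF : (ω' : F) ^ k ≠ 0 := pow_ne_zero k (by simpa using hω')
  have hsurj := toEnd_surjective E (pow_ne_zero k hω') h2
  refine ⟨fun h => ?_, fun h => ?_⟩
  · have hR : ω ^ k = -ω' ^ k := by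
      rw [div_pow, div_eq_iff hF, neg_one_mul] at h
      exact Subtype.ext (by simpa using h)
    have hω : ω ≠ 0 := by
      rintro rfl
      rw [zero_pow hk.ne', zero_eq_neg] at hR
      exact pow_ne_zero k hω' hR
    exact ⟨isPreperiodicWithPair_diagonal_lattes E hsurj hk (Or.inr hR) n,
      not_isPreperiodicWithPair_diagonal E hω hω' h2 hR n⟩
  · have hR : ω ^ k = ω' ^ k := by
      rw [div_pow, div_eq_iff hF, one_mul] at h
      exact Subtype.ext (by simpa using h)
    exact ⟨isPreperiodicWithPair_diagonal E hsurj hk hR n,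
      isPreperiodicWithPair_diagonal_lattes E hsurj hk (Or.inl hR) n⟩
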